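/- All rings are commutative with $1$. Let $(R,\mathfrak m,K)$ be a local ring with maximal ideal $\mathfrak m$ and residue field $K=R/\mathfrak m$; a bar denotes reduction of coefficients modulo $\mathfrak m$. An \emph{étale neighborhood} of $R$ is a pair $(S,\mathfrak q)$ where $S$ is an étale $R$-algebra (i.e. formally étale and finitely presented) and $\mathfrak q$ is a prime ideal of $S$ lying over $\mathfrak m$ such that the induced map of residue fields $K\to S_{\mathfrak q}/\mathfrak q S_{\mathfrak q}$ is an isomorphism. A \emph{pointed étale extension} of $R$ is an $R$-algebra $T$ that is isomorphic to $S_{\mathfrak q}$ for some étale neighborhood $(S,\mathfrak q)$ of $R$. \textbf{Theorem.} The following conditions are equivalent: (1) $R$ is Henselian, that is: for every monic $f\in R[t]$ and all monic coprime $p_0,q_0\in K[t]$ with $\bar f=p_0q_0$ there is a unique pair of monic polynomials $p,q\in R[t]$ with $\bar p=p_0$, $\bar q=q_0$, $\deg p=\deg p_0$, $\deg q=\deg q_0$ and $f=pq$. (2) If $f\in R[t]$ is a monic polynomial and $\lambda\in K$ is a simple root of $\bar f\in K[t]$, then there is an $r\in R$ with $r\equiv\lambda \bmod \mathfrak m$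 and $f(r)=0$. (3) For every pointed étale extension $T$ of $R$ one has $R\cong T$ as $R$-algebras. (4) For every $n\in\mathbb N$ and all $f_1,\dots,f_n\in R[x_1,\dots,x_n]$ and $(\lambda_1,\dots,\lambda_n)\in K^n$ such that $\bar f_j(\lambda_1,\dots,\lambda_n)=0$ for all $j$ and the reduction modulo $\mathfrak m$ of the Jacobian determinant $\det\left(\frac{\partial f_j}{\partial x_i}\right)$ does not vanish at $(\lambda_1,\dots,\lambda_n)$, there are unique $r_1,\dots,r_n\in R$ such that $r_i\equiv\lambda_i \bmod\mathfrak m$ for all $i$ and $f_j(r_1,\dots,r_n)=0$ for all $j$. -/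

import Mathlib

universe u

open Polynomial IsLocalRing

/-- Hensel's property for a local ring `R`: every factorization of the reduction of a monic
polynomial into two monic coprime polynomials over the residue field lifts uniquely to a
factorization into two monic polynomials over `R` of the same degrees. -/
def IsHenselian (R : Type u) [CommRing R] [IsLocalRing R] : Prop :=
  ∀ f : R[X], f.Monic → ∀ p₀ q₀ : (ResidueField R)[X], p₀.Monic → q₀.Monic → IsCoprime p₀ q₀ →
    f.map (residue R) = p₀ * q₀ →
    ∃! pq : R[X] × R[X], pq.1.Monic ∧ pq.2.Monic ∧
      pq.1.map (residue R) = p₀ ∧ pq.2.map (residue R) = q₀ ∧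
      pq.1.degree = p₀.degree ∧ pq.2.degree = q₀.degree ∧ f = pq.1 * pq.2

/-- If `q` lies over the maximal ideal of `R`, then `R → S_q` is a local homomorphism, so that it
induces a map of residue fields. -/
theorem isLocalHom_algebraMap_localizationAtPrime (R S : Type u) [CommRing R] [IsLocalRing R]
    [CommRing S] [Algebra R S] (q : Ideal S) [q.IsPrime] [h : q.LiesOver (maximalIdeal R)] :
    IsLocalHom (algebraMap R (Localization.AtPrime q)) := by
  constructor
  intro a ha
  by_contra hn
  have ham : a ∈ maximalIdeal R := hn
  rw [h.over, Ideal.mem_comap] at ham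
  rw [IsScalarTower.algebraMap_apply R S (Localization.AtPrime q),
    IsLocalization.AtPrime.isUnit_to_map_iff (Localization.AtPrime q) q] at ha
  exact ha ham

/-- `(S, q)` is an étale neighborhood of the local ring `R`: `S` is an étale `R`-algebra and `q` is
a prime ideal of `S` lying over the maximal ideal of `R` such that the induced map of residue
fields from that of `R` to that of `S_q` is an isomorphism. -/
structure IsEtaleNeighborhood (R S : Type u) [CommRing R] [IsLocalRing R] [CommRing S]
    [Algebra R S] (q : Ideal S) [q.IsPrime] : Prop where
  etale : Algebra.Etale R S
  liesOver : q.LiesOver (maximalIdeal R)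
  bijective_residueField :
    haveI := isLocalHom_algebraMap_localizationAtPrime R S q
    Function.Bijective (ResidueField.map (algebraMap R (Localization.AtPrime q)))

/-- The `R`-algebra `T` is a pointed étale extension of the local ring `R`: it is (as an
`R`-algebra) the localization `S_q` for some étale neighborhood `(S, q)` of `R`. Every étale
`R`-algebra is finitely presented, so the universe of `R` contains a copy of each of them. -/
def IsPointedEtaleExtension (R T : Type u) [CommRing R] [IsLocalRing R] [CommRing T]
    [Algebra R T] : Prop :=
  ∃ (S : Type u) (_ : CommRing S) (_ : Algebra R S) (_ : Algebra S T) (_ : IsScalarTower R S T)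
    (q : Ideal S) (_ : q.IsPrime), IsEtaleNeighborhood R S q ∧ IsLocalization.AtPrime T q

/-!
All four conditions say that, for an étale `R`-algebra `S`, every `R`-algebra homomorphism `S → K`
lifts to an `R`-algebra homomorphism `S → R`. Such a lift is unique for any `S` unramified over `R`,
and it exists when simple roots lift, because near the given `K`-point `S` is standard étale, that
is, of the form `(R[t] / (f))[1 / g]` with `f` monic and `f'` invertible.

Coprime monic factorizations of `f` are classified by an étale `R`-algebra, and so are the zeros of
a square system of polynomials at which the Jacobian determinant is invertible. For a pointed étale
extension `S_q`, the prime `q` is the kernel of a homomorphism `S → K`, and a lift `S → R` of it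
induces an inverse of `R → S_q`. Conversely a simple root `a` of `f` is lifted by lifting the factor
`X - a`, by the isomorphism of `R` with the localization of `(R[t] / (f))[1 / f']` at the point `a`,
or by the Jacobian criterion in one variable.
-/

section Unramified

open scoped TensorProduct

-- If `t` is the idempotent cutting out the diagonal of `S ⊗[R] S`, then `(ψ, ψ')` maps `t` to a
-- unit, because it does so after composition with `π`, and this unit annihilates `ψ s - ψ' s`.
theorem algHom_eq_of_comp_eq_of_isLocalHom {R S A B : Type*} [CommRing R] [CommRing S]
    [Algebra R S] [Algebra.FormallyUnramified R S] [Algebra.EssFiniteType R S] [CommRing A]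
    [Algebra R A] [CommRing B] [Algebra R B] (π : A →ₐ[R] B) [IsLocalHom π] {ψ ψ' : S →ₐ[R] A}
    (h : π.comp ψ = π.comp ψ') : ψ = ψ' := by
  obtain ⟨t, ht_annihilates, ht_one⟩ :=
    Algebra.FormallyUnramified.iff_exists_tensorProduct.mp ‹Algebra.FormallyUnramified R S›
  let δ : S ⊗[R] S →ₐ[R] A := Algebra.TensorProduct.productMap ψ' ψ
  have hπδ : π.comp δ = (π.comp ψ).comp (Algebra.TensorProduct.lmul' R) := by
    ext s
    · simpa [δ] using congr($h.symm s)
    · simp [δ]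
  have hunit : IsUnit (δ t) := by
    refine isUnit_of_map_unit π _ ?_
    have hδt : π (δ t) = 1 := by simpa [ht_one] using congr($hπδ t)
    exact hδt ▸ isUnit_one
  ext s
  have hs : (ψ s - ψ' s) * δ t = 0 := by simpa [δ] using congr(δ $(ht_annihilates s))
  exact sub_eq_zero.mp (hunit.mul_left_eq_zero.mp hs)

theorem nonempty_algEquiv_of_section {R S T : Type*} [CommRing R] [IsLocalRing R] [CommRing S]
    [Algebra R S] [Algebra.FormallyUnramified R S] [Algebra.EssFiniteType R S] [CommRing T]
    [Algebra R T] [Algebra S T] [IsScalarTower R S T] (σ : S →ₐ[R] R)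
    [IsLocalization.AtPrime T ((maximalIdeal R).comap σ)] : Nonempty (R ≃ₐ[R] T) := by
  let q := (maximalIdeal R).comap σ
  have : IsLocalRing T := IsLocalization.AtPrime.isLocalRing T q
  let π : T →ₐ[R] ResidueField T := IsScalarTower.toAlgHom R T (ResidueField T)
  have : IsLocalHom π := ⟨fun t ht ↦ isUnit_of_map_unit (residue T) t ht⟩
  have hσ : (Algebra.ofId R T).comp σ = IsScalarTower.toAlgHom R S T := by
    refine algHom_eq_of_comp_eq_of_isLocalHom π (AlgHom.ext fun s ↦ ?_)
    have hs : algebraMap R S (σ s) - s ∈ q := by simp [q, Ideal.mem_comap]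
    rw [← IsLocalization.AtPrime.to_map_mem_maximal_iff T q, map_sub,
      ← IsScalarTower.algebraMap_apply, ← residue_eq_zero_iff, map_sub, sub_eq_zero] at hs
    exact hs
  let χ : T →ₐ[R] R := IsLocalization.liftAlgHom (M := q.primeCompl) (f := σ)
    fun y ↦ notMem_maximalIdeal.mp y.2
  refine ⟨AlgEquiv.ofAlgHom (Algebra.ofId R T) χ ?_ (by ext)⟩
  refine IsLocalization.algHom_ext q.primeCompl (AlgHom.ext fun s ↦ ?_)
  have hχ : χ (algebraMap S T s) = σ s := IsLocalization.lift_eq _ s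
  exact (congrArg (algebraMap R T) hχ).trans congr($hσ s)

end Unramified

section EtaleNeighborhood

variable {R S : Type u} [CommRing R] [IsLocalRing R] [CommRing S] [Algebra R S]

theorem isEtaleNeighborhood_of_ker_eq [Algebra.Etale R S] {q : Ideal S} [q.IsPrime]
    (φ : S →ₐ[R] ResidueField R) (hφ : RingHom.ker φ = q) : IsEtaleNeighborhood R S q := by
  have hlies : q.LiesOver (maximalIdeal R) := ⟨by
    ext r
    rw [Ideal.mem_comap, ← hφ, RingHom.mem_ker, φ.commutes, ResidueField.algebraMap_eq,
      residue_eq_zero_iff]⟩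
  have := isLocalHom_algebraMap_localizationAtPrime R S q
  let φq : Localization.AtPrime q →ₐ[R] ResidueField R :=
    IsLocalization.liftAlgHom (M := q.primeCompl) (f := φ)
      fun y ↦ isUnit_iff_ne_zero.mpr fun hy ↦ y.2 (hφ.le hy)
  have hφq (r : R) : φq (algebraMap R _ r) = residue R r := φq.commutes r
  have : IsLocalHom φq.toRingHom := .of_surjective _ fun x ↦
    let ⟨r, hr⟩ := residue_surjective x
    ⟨algebraMap R _ r, (hφq r).trans hr⟩
  let inv : ResidueField (Localization.AtPrime q) →+* ResidueField R :=
    ResidueField.lift φq.toRingHom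
  refine ⟨inferInstance, hlies, RingHom.injective _, fun x ↦ ⟨inv x, inv.injective ?_⟩⟩
  obtain ⟨r, hr⟩ := residue_surjective (inv x)
  rw [← hr, ResidueField.map_residue]
  exact hφq r

theorem IsEtaleNeighborhood.exists_ker_eq {q : Ideal S} [q.IsPrime]
    (h : IsEtaleNeighborhood R S q) : ∃ φ : S →ₐ[R] ResidueField R, RingHom.ker φ = q := by
  have := h.liesOver
  have := isLocalHom_algebraMap_localizationAtPrime R S q
  let e := RingEquiv.ofBijective _ h.bijective_residueField
  let φ : S →+* ResidueField R := (e.symm : _ →+* ResidueField R).comp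
    ((residue (Localization.AtPrime q)).comp (algebraMap S _))
  refine ⟨⟨φ, fun r ↦ ?_⟩, ?_⟩
  · change e.symm _ = _
    rw [RingEquiv.symm_apply_eq, RingHom.comp_apply, ← IsScalarTower.algebraMap_apply]
    rfl
  · ext s
    change e.symm _ = 0 ↔ _
    rw [map_eq_zero_iff _ e.symm.injective, RingHom.comp_apply, residue_eq_zero_iff,
      IsLocalization.AtPrime.to_map_mem_maximal_iff _ q]

end EtaleNeighborhood

section HenselianLocalRing

theorem rootMultiplicity_eq_one_iff {R : Type*} [CommRing R] {p : R[X]} {a : R} (hp : p ≠ 0) :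
    p.rootMultiplicity a = 1 ↔ p.IsRoot a ∧ ¬ (derivative p).IsRoot a := by
  have hroot := rootMultiplicity_pos hp (x := a)
  have hmultiple := one_lt_rootMultiplicity_iff_isRoot hp (t := a)
  grind

theorem henselianLocalRing_iff_forall_aeval_eq_zero (R : Type u) [CommRing R] [IsLocalRing R] :
    HenselianLocalRing R ↔ ∀ f : R[X], f.Monic → ∀ a : ResidueField R, aeval a f = 0 →
      aeval a (derivative f) ≠ 0 → ∃ r : R, f.IsRoot r ∧ residue R r = a :=
  (HenselianLocalRing.TFAE R).out 0 1

theorem henselianLocalRing_iff_forall_rootMultiplicity_eq_one (R : Type u) [CommRing R]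
    [IsLocalRing R] :
    HenselianLocalRing R ↔ ∀ f : R[X], f.Monic → ∀ a : ResidueField R,
      (f.map (residue R)).rootMultiplicity a = 1 → ∃ r : R, residue R r = a ∧ f.eval r = 0 := by
  refine (henselianLocalRing_iff_forall_aeval_eq_zero R).trans (forall₃_congr fun f hf a ↦ ?_)
  rw [rootMultiplicity_eq_one_iff (hf.map (residue R)).ne_zero, IsRoot, IsRoot, derivative_map,
    ← ResidueField.algebraMap_eq, eval_map_algebraMap, eval_map_algebraMap, and_imp]
  simp only [ResidueField.algebraMap_eq, IsRoot, and_comm, ne_eq]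

theorem exists_algHom_comp_eq {R S : Type*} [CommRing R] [HenselianLocalRing R] [CommRing S]
    [Algebra R S] [Algebra.Etale R S] (φ : S →ₐ[R] ResidueField R) :
    ∃ ψ : S →ₐ[R] R, (Algebra.ofId R (ResidueField R)).comp ψ = φ := by
  have hprime : (RingHom.ker φ).IsPrime := RingHom.ker_isPrime _
  obtain ⟨g, hg, hstd⟩ := Algebra.IsEtaleAt.exists_isStandardEtale (R := R) (RingHom.ker φ)
  obtain ⟨P⟩ := hstd.nonempty_standardEtalePresentation
  let φg : Localization.Away g →ₐ[R] ResidueField R :=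
    IsLocalization.Away.liftAlgHom g (f := φ) (isUnit_iff_ne_zero.mpr hg)
  have hφx : P.P.HasMap (φg P.x) := P.hasMap.map φg
  obtain ⟨r, hfr, hr⟩ : ∃ r : R, P.f.IsRoot r ∧ residue R r = φg P.x :=
    (henselianLocalRing_iff_forall_aeval_eq_zero R).mp ‹_› P.f P.monic_f _ hφx.1
      hφx.isUnit_derivative_f.ne_zero
  have hmap : P.P.HasMap r := by
    refine ⟨hfr, isUnit_of_map_unit (residue R) _ ?_⟩
    rw [← ResidueField.algebraMap_eq, ← aeval_algebraMap_apply, ResidueField.algebraMap_eq, hr]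
    exact hφx.2
  let ψg : Localization.Away g →ₐ[R] R := (P.P.lift r hmap).comp P.equivRing.toAlgHom
  have hψg : (Algebra.ofId R (ResidueField R)).comp ψg = φg :=
    P.hom_ext (by simpa [ψg] using hr)
  refine ⟨ψg.comp (IsScalarTower.toAlgHom R S _), ?_⟩
  rw [← AlgHom.comp_assoc, hψg]
  ext s
  simp [φg]

theorem IsPointedEtaleExtension.nonempty_algEquiv {R T : Type u} [CommRing R]
    [HenselianLocalRing R] [CommRing T] [Algebra R T] (hT : IsPointedEtaleExtension R T) :
    Nonempty (R ≃ₐ[R] T) := by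
  obtain ⟨S, _, _, _, _, q, _, hS, _⟩ := hT
  have := hS.etale
  obtain ⟨φ, hφ⟩ := hS.exists_ker_eq
  obtain ⟨ψ, hψ⟩ := exists_algHom_comp_eq φ
  have hq : q = (maximalIdeal R).comap ψ := by
    ext s
    rw [← hφ, RingHom.mem_ker, Ideal.mem_comap, ← hψ, ← residue_eq_zero_iff]
    rfl
  subst hq
  exact nonempty_algEquiv_of_section ψ

theorem exists_algHom_comp_eq_of_nonempty_algEquiv {R S : Type*} [CommRing R] [IsLocalRing R]
    [CommRing S] [Algebra R S] (φ : S →ₐ[R] ResidueField R) [(RingHom.ker φ).IsPrime]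
    (h : Nonempty (R ≃ₐ[R] Localization.AtPrime (RingHom.ker φ))) :
    ∃ ψ : S →ₐ[R] R, (Algebra.ofId R (ResidueField R)).comp ψ = φ := by
  obtain ⟨e⟩ := h
  let q := RingHom.ker φ
  let φq : Localization.AtPrime q →ₐ[R] ResidueField R :=
    IsLocalization.liftAlgHom (M := q.primeCompl) (f := φ) fun y ↦ isUnit_iff_ne_zero.mpr y.2
  have hφq : (Algebra.ofId R (ResidueField R)).comp e.symm.toAlgHom = φq := by
    have hid : φq.comp e.toAlgHom = Algebra.ofId R (ResidueField R) := by ext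
    exact AlgHom.ext fun t ↦ by simpa using congr($hid.symm (e.symm t))
  refine ⟨e.symm.toAlgHom.comp (IsScalarTower.toAlgHom R S _), ?_⟩
  rw [← AlgHom.comp_assoc, hφq]
  ext s
  simp [φq, q]

theorem henselianLocalRing_of_forall_isPointedEtaleExtension {R : Type u} [CommRing R]
    [IsLocalRing R] (H : ∀ (T : Type u) [CommRing T] [Algebra R T],
      IsPointedEtaleExtension R T → Nonempty (R ≃ₐ[R] T)) : HenselianLocalRing R := by
  refine (henselianLocalRing_iff_forall_aeval_eq_zero R).mpr fun f hf a hroot hder ↦ ?_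
  let P : StandardEtalePair R := ⟨f, hf, derivative f, 1, 0, 1, by simp⟩
  let φ : P.Ring →ₐ[R] ResidueField R := P.lift a ⟨hroot, hder.isUnit⟩
  have hprime : (RingHom.ker φ).IsPrime := RingHom.ker_isPrime _
  obtain ⟨ψ, hψ⟩ := exists_algHom_comp_eq_of_nonempty_algEquiv φ <| H _
    ⟨P.Ring, _, _, _, inferInstance, _, _, isEtaleNeighborhood_of_ker_eq φ rfl, inferInstance⟩
  refine ⟨ψ P.X, (P.hasMap_X.map ψ).1, ?_⟩
  exact congr($hψ P.X).trans (P.lift_X a _)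

end HenselianLocalRing

section Factorization

theorem isCoprime_of_isCoprime_map {A B : Type*} [CommRing A] [CommRing B] [Nontrivial B]
    (π : A →+* B) [IsLocalHom π] {p q : A[X]} (hp : p.Monic) (hq : q.Monic)
    (h : IsCoprime (p.map π) (q.map π)) : IsCoprime p q := by
  rw [← isUnit_resultant_iff_isCoprime (hp.map π), hp.natDegree_map, hq.natDegree_map,
    resultant_map_map] at h
  exact (isUnit_resultant_iff_isCoprime hp).mp (isUnit_of_map_unit π _ h)

theorem eq_of_mul_eq_mul_of_map_eq {A B : Type*} [CommRing A] [CommRing B] [Nontrivial B]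
    (π : A →+* B) [IsLocalHom π] {p q p' q' : A[X]} (hp : p.Monic) (hq' : q'.Monic)
    (hp' : p'.Monic) (hcop : IsCoprime (p.map π) (q'.map π)) (hpp' : p.map π = p'.map π)
    (h : p * q = p' * q') : p = p' := by
  have hdvd : p ∣ p' :=
    (isCoprime_of_isCoprime_map π hp hq' hcop).dvd_of_dvd_mul_right (h ▸ dvd_mul_right p q)
  refine (eq_of_monic_of_dvd_of_natDegree_le hp hp' hdvd ?_).symm
  rw [← hp'.natDegree_map π, ← hpp', hp.natDegree_map]

theorem exists_mul_eq_of_map_eq_mul {R : Type*} [CommRing R] [HenselianLocalRing R] {f : R[X]}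
    (hf : f.Monic) {p₀ q₀ : (ResidueField R)[X]} (hp₀ : p₀.Monic) (hq₀ : q₀.Monic)
    (hcop : IsCoprime p₀ q₀) (hfac : f.map (residue R) = p₀ * q₀) :
    ∃ p q : R[X], p.Monic ∧ q.Monic ∧ p.map (residue R) = p₀ ∧ q.map (residue R) = q₀ ∧
      f = p * q := by
  have hdeg : f.natDegree = p₀.natDegree + q₀.natDegree := by
    rw [← hp₀.natDegree_mul hq₀, ← hfac, hf.natDegree_map]
  let F : MonicDegreeEq R f.natDegree := .mk f hf rfl
  let E (A : Type _) [CommRing A] [Algebra R A] :=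
    UniversalCoprimeFactorizationRing.homEquiv A _ _ hdeg F
  let φ := (E (ResidueField R)).symm ⟨(.mk p₀ hp₀ rfl, .mk q₀ hq₀ rfl), hfac.symm, hcop⟩
  obtain ⟨ψ, hψ⟩ := exists_algHom_comp_eq φ
  rw [Equiv.eq_symm_apply, Subtype.ext_iff, Prod.ext_iff,
    UniversalCoprimeFactorizationRing.homEquiv_comp_fst,
    UniversalCoprimeFactorizationRing.homEquiv_comp_snd, Subtype.ext_iff, Subtype.ext_iff] at hψ
  let pq := E R ψ
  exact ⟨pq.1.1, pq.1.2, pq.1.1.monic, pq.1.2.monic, hψ.1, hψ.2, by simpa [F] using pq.2.1.symm⟩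

theorem isHenselian_of_henselianLocalRing (R : Type u) [CommRing R] [HenselianLocalRing R] :
    IsHenselian R := by
  intro f hf p₀ q₀ hp₀ hq₀ hcop hfac
  obtain ⟨p, q, hp, hq, hpp₀, hqq₀, hpq⟩ := exists_mul_eq_of_map_eq_mul hf hp₀ hq₀ hcop hfac
  refine ⟨(p, q), ⟨hp, hq, hpp₀, hqq₀, ?_, ?_, hpq⟩, ?_⟩
  · rw [← hpp₀, hp.degree_map]
  · rw [← hqq₀, hq.degree_map]
  rintro ⟨p', q'⟩ ⟨hp', hq', hpp₀', hqq₀', -, -, hpq'⟩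
  have hmul : p' * q' = p * q := hpq'.symm.trans hpq
  refine Prod.ext ?_ ?_
  · refine eq_of_mul_eq_mul_of_map_eq (residue R) hp' hq hp ?_ (hpp₀'.trans hpp₀.symm) hmul
    rwa [hpp₀', hqq₀]
  · refine eq_of_mul_eq_mul_of_map_eq (residue R) hq' hp hq ?_ (hqq₀'.trans hqq₀.symm)
      ((mul_comm _ _).trans (hmul.trans (mul_comm _ _)))
    rw [hpp₀, hqq₀']
    exact hcop.symm

theorem henselianLocalRing_of_isHenselian {R : Type u} [CommRing R] [IsLocalRing R]
    (H : IsHenselian R) : HenselianLocalRing R := by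
  refine (henselianLocalRing_iff_forall_aeval_eq_zero R).mpr fun f hf a hroot hder ↦ ?_
  rw [aeval_def, ← eval_map, ResidueField.algebraMap_eq] at hroot hder
  obtain ⟨q₀, hq₀⟩ := dvd_iff_isRoot.mpr hroot
  have hcop : IsCoprime (X - C a) q₀ := by
    refine (irreducible_X_sub_C a).coprime_iff_not_dvd.mpr fun hdvd ↦ hder ?_
    rw [← derivative_map, hq₀]
    simpa [derivative_mul] using dvd_iff_isRoot.mp hdvd
  obtain ⟨⟨p, q⟩, ⟨hp, -, hpp₀, -, hdeg, -, hpq⟩, -⟩ := H f hf (X - C a) q₀ (monic_X_sub_C a)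
    ((monic_X_sub_C a).of_mul_monic_left (hq₀ ▸ hf.map _)) hcop hq₀
  dsimp only at hp hpp₀ hdeg hpq
  obtain ⟨r, rfl⟩ : ∃ r, p = X - C r := by
    have hp_natDegree := natDegree_eq_of_degree_eq_some (hdeg.trans (degree_X_sub_C a))
    exact ⟨-p.coeff 0, by simpa using hp.eq_X_add_C hp_natDegree⟩
  exact ⟨r, dvd_iff_isRoot.mp ⟨q, hpq⟩, by simpa using hpp₀⟩

end Factorization

section Jacobian

theorem etale_localizationAway_jacobian {R S T ι σ : Type*} [CommRing R] [CommRing S] [Algebra R S]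
    [CommRing T] [Algebra R T] [Algebra S T] [IsScalarTower R S T] [Finite ι] [Finite σ]
    (P : Algebra.PreSubmersivePresentation R S ι σ) (hP : P.dimension = 0)
    [IsLocalization.Away P.jacobian T] : Algebra.Etale R T := by
  let Q : Algebra.SubmersivePresentation R T _ _ :=
    { toPreSubmersivePresentation := .comp (.localizationAway T P.jacobian) P
      jacobian_isUnit := by
        simp [Algebra.smul_def, -isUnit_map_iff, IsLocalization.Away.algebraMap_isUnit] }
  have : Algebra.IsStandardSmoothOfRelativeDimension 0 R T :=
    Q.isStandardSmoothOfRelativeDimension <| by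
      simp only [Algebra.PreSubmersivePresentation.dimension_comp_eq_dimension_add_dimension, hP, Q]
      simp [Algebra.Presentation.dimension]
  infer_instance

theorem eval_map_residue {R σ : Type*} [CommRing R] [IsLocalRing R] (a : σ → ResidueField R)
    (p : MvPolynomial σ R) :
    MvPolynomial.eval a (MvPolynomial.map (residue R) p) = MvPolynomial.aeval a p := by
  rw [MvPolynomial.eval_map]
  rfl

theorem aeval_aeval_mvPolynomial_X {R A σ : Type*} [CommRing R] [CommRing A] [Algebra R A]
    (r : σ → A) (i : σ) (p : R[X]) :
    MvPolynomial.aeval r (aeval (MvPolynomial.X i : MvPolynomial σ R) p) = aeval (r i) p := by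
  rw [← aeval_algHom_apply, MvPolynomial.aeval_X]

variable {R ι : Type*} [CommRing R] [Fintype ι] [DecidableEq ι]

/-- The Jacobian determinant of a system of as many polynomials as there are variables. -/
noncomputable def jacobianDet (f : ι → MvPolynomial ι R) : MvPolynomial ι R :=
  Matrix.det (Matrix.of fun i j => MvPolynomial.pderiv i (f j))

/-- The étale locus `(R[x] / (f))[1 / jacobianDet f]` of the scheme of zeros of the system `f`. It
represents the functor of zeros of `f` at which the Jacobian determinant is invertible. -/
abbrev JacobianLocalization (f : ι → MvPolynomial ι R) : Type _ :=
  Localization.Away (Ideal.Quotient.mk (Ideal.span (Set.range f)) (jacobianDet f))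

namespace JacobianLocalization

variable (f : ι → MvPolynomial ι R)

instance etale : Algebra.Etale R (JacobianLocalization f) := by
  let P := Algebra.PreSubmersivePresentation.naive (v := f) id Function.injective_id
  have hjac : P.jacobian = Ideal.Quotient.mk (Ideal.span (Set.range f)) (jacobianDet f) := by
    have hmat : P.jacobiMatrix = Matrix.of fun i j => MvPolynomial.pderiv i (f j) := by
      ext i j : 1
      exact P.jacobiMatrix_apply i j
    rw [P.jacobian_eq_jacobiMatrix_det, hmat, P.algebraMap_apply]
    exact congr($((MvPolynomial.aeval_unique (Ideal.Quotient.mkₐ R _)).symm) _)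
  have : IsLocalization.Away P.jacobian (JacobianLocalization f) := by
    rw [hjac]
    infer_instance
  exact etale_localizationAway_jacobian P (by simp [Algebra.Presentation.dimension])

/-- The universal zero of the system `f`. -/
noncomputable def root (i : ι) : JacobianLocalization f :=
  algebraMap _ _ (Ideal.Quotient.mk (Ideal.span (Set.range f)) (MvPolynomial.X i))

theorem aeval_root (p : MvPolynomial ι R) :
    MvPolynomial.aeval (root f) p =
      algebraMap _ _ (Ideal.Quotient.mk (Ideal.span (Set.range f)) p) :=
  congr($((MvPolynomial.aeval_unique ((IsScalarTower.toAlgHom R _ (JacobianLocalization f)).comp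
    (Ideal.Quotient.mkₐ R (Ideal.span (Set.range f))))).symm) p)

theorem aeval_root_self (j : ι) : MvPolynomial.aeval (root f) (f j) = 0 := by
  rw [aeval_root, Ideal.Quotient.eq_zero_iff_mem.mpr (Ideal.subset_span (Set.mem_range_self j)),
    map_zero]

variable {f} {A : Type*} [CommRing A] [Algebra R A]

theorem algHom_ext {ψ ψ' : JacobianLocalization f →ₐ[R] A} (h : ∀ i, ψ (root f i) = ψ' (root f i)) :
    ψ = ψ' := by
  refine IsLocalization.algHom_ext
    (.powers (Ideal.Quotient.mk (Ideal.span (Set.range f)) (jacobianDet f))) ?_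
  exact Ideal.Quotient.algHom_ext _ (MvPolynomial.algHom_ext h)

/-- The homomorphism classifying a zero of `f` at which the Jacobian determinant is invertible. -/
noncomputable def lift (r : ι → A) (hr : ∀ j, MvPolynomial.aeval r (f j) = 0)
    (hu : IsUnit (MvPolynomial.aeval r (jacobianDet f))) : JacobianLocalization f →ₐ[R] A :=
  IsLocalization.Away.liftAlgHom (Ideal.Quotient.mk (Ideal.span (Set.range f)) (jacobianDet f))
    (f := Ideal.Quotient.liftₐ (Ideal.span (Set.range f)) (MvPolynomial.aeval r)
      (Ideal.span_le (I := RingHom.ker _).mpr (Set.range_subset_iff.mpr hr))) hu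

theorem lift_root (r : ι → A) (hr : ∀ j, MvPolynomial.aeval r (f j) = 0)
    (hu : IsUnit (MvPolynomial.aeval r (jacobianDet f))) (i : ι) : lift r hr hu (root f i) = r i :=
  (IsLocalization.Away.lift_eq (S := JacobianLocalization f)
    (Ideal.Quotient.mk (Ideal.span (Set.range f)) (jacobianDet f)) hu _).trans
      (MvPolynomial.aeval_X r i)

end JacobianLocalization

theorem eq_of_aeval_eq_zero_of_isUnit_jacobianDet {A B : Type*} [CommRing A] [Algebra R A]
    [CommRing B] [Algebra R B] (π : A →ₐ[R] B) [IsLocalHom π] {f : ι → MvPolynomial ι R}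
    {r r' : ι → A} (hr : ∀ j, MvPolynomial.aeval r (f j) = 0)
    (hr' : ∀ j, MvPolynomial.aeval r' (f j) = 0) (h : ∀ i, π (r i) = π (r' i))
    (hu : IsUnit (MvPolynomial.aeval (fun i ↦ π (r i)) (jacobianDet f))) : r = r' := by
  have isUnit_of_comp {s : ι → A}
      (hs : IsUnit (MvPolynomial.aeval (fun i ↦ π (s i)) (jacobianDet f))) :
      IsUnit (MvPolynomial.aeval s (jacobianDet f)) := by
    refine isUnit_of_map_unit π _ ?_
    rwa [MvPolynomial.comp_aeval_apply]
  let ψ := JacobianLocalization.lift r hr (isUnit_of_comp hu)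
  let ψ' := JacobianLocalization.lift r' hr' (isUnit_of_comp (funext h ▸ hu))
  have hψ : ψ = ψ' := by
    refine algHom_eq_of_comp_eq_of_isLocalHom π (JacobianLocalization.algHom_ext fun i ↦ ?_)
    simpa [ψ, ψ', JacobianLocalization.lift_root] using h i
  ext i
  simpa [ψ, ψ', JacobianLocalization.lift_root] using congr($hψ (.root f i))

theorem exists_aeval_eq_zero_of_isUnit_jacobianDet [HenselianLocalRing R] (f : ι → MvPolynomial ι R)
    (a : ι → ResidueField R) (hroot : ∀ j, MvPolynomial.aeval a (f j) = 0)
    (hu : IsUnit (MvPolynomial.aeval a (jacobianDet f))) :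
    ∃ r : ι → R, (∀ i, residue R (r i) = a i) ∧ ∀ j, MvPolynomial.aeval r (f j) = 0 := by
  obtain ⟨ψ, hψ⟩ := exists_algHom_comp_eq (JacobianLocalization.lift a hroot hu)
  refine ⟨fun i ↦ ψ (.root f i), fun i ↦ ?_, fun j ↦ ?_⟩
  · rw [← JacobianLocalization.lift_root a hroot hu i, ← hψ]
    rfl
  · rw [← MvPolynomial.comp_aeval_apply, JacobianLocalization.aeval_root_self, map_zero]

theorem existsUnique_eval_eq_zero [HenselianLocalRing R] (f : ι → MvPolynomial ι R)
    (a : ι → ResidueField R)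
    (hroot : ∀ j, MvPolynomial.eval a (MvPolynomial.map (residue R) (f j)) = 0)
    (hjac : MvPolynomial.eval a (MvPolynomial.map (residue R) (jacobianDet f)) ≠ 0) :
    ∃! r : ι → R, (∀ i, residue R (r i) = a i) ∧ ∀ j, MvPolynomial.eval r (f j) = 0 := by
  simp only [eval_map_residue] at hroot hjac
  obtain ⟨r, hr, hfr⟩ := exists_aeval_eq_zero_of_isUnit_jacobianDet f a hroot hjac.isUnit
  refine ⟨r, ⟨hr, hfr⟩, fun r' ⟨hr', hfr'⟩ ↦ ?_⟩
  let π : R →ₐ[R] ResidueField R := Algebra.ofId R (ResidueField R)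
  have : IsLocalHom π := ⟨fun t ht ↦ isUnit_of_map_unit (residue R) t ht⟩
  refine eq_of_aeval_eq_zero_of_isUnit_jacobianDet π hfr' hfr
    (fun i ↦ (hr' i).trans (hr i).symm) ?_
  exact (funext hr' : (fun i ↦ π (r' i)) = a) ▸ hjac.isUnit

theorem henselianLocalRing_of_forall_exists_eval_eq_zero [IsLocalRing R]
    (H : ∀ (f : Fin 1 → MvPolynomial (Fin 1) R) (a : Fin 1 → ResidueField R),
      (∀ j, MvPolynomial.eval a (MvPolynomial.map (residue R) (f j)) = 0) →
      MvPolynomial.eval a (MvPolynomial.map (residue R) (jacobianDet f)) ≠ 0 →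
      ∃ r : Fin 1 → R, (∀ i, residue R (r i) = a i) ∧ ∀ j, MvPolynomial.eval r (f j) = 0) :
    HenselianLocalRing R := by
  refine (henselianLocalRing_iff_forall_aeval_eq_zero R).mpr fun f _ a hroot hder ↦ ?_
  let F : Fin 1 → MvPolynomial (Fin 1) R := fun _ ↦ aeval (MvPolynomial.X 0) f
  have hjac : jacobianDet F = aeval (MvPolynomial.X 0) (derivative f) := by
    simp [jacobianDet, F, Derivation.map_aeval]
  obtain ⟨r, hr, hfr⟩ := H F (fun _ ↦ a)
    (fun _ ↦ by rw [eval_map_residue, aeval_aeval_mvPolynomial_X, hroot])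
    (by rwa [eval_map_residue, hjac, aeval_aeval_mvPolynomial_X])
  exact ⟨r 0, (aeval_aeval_mvPolynomial_X r 0 f).symm.trans (hfr 0), hr 0⟩

end Jacobian

theorem mainTheorem7 (R : Type u) [CommRing R] [IsLocalRing R] :
    List.TFAE
      [IsHenselian R,
        ∀ f : R[X], f.Monic → ∀ a : ResidueField R,
          (f.map (residue R)).rootMultiplicity a = 1 →
          ∃ r : R, residue R r = a ∧ f.eval r = 0,
        ∀ (T : Type u) [CommRing T] [Algebra R T],
          IsPointedEtaleExtension R T → Nonempty (R ≃ₐ[R] T),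
        ∀ (n : ℕ) (f : Fin n → MvPolynomial (Fin n) R) (a : Fin n → ResidueField R),
          (∀ j, MvPolynomial.eval a (MvPolynomial.map (residue R) (f j)) = 0) →
          MvPolynomial.eval a (MvPolynomial.map (residue R)
            (Matrix.det (Matrix.of fun i j => MvPolynomial.pderiv i (f j)))) ≠ 0 →
          ∃! r : Fin n → R, (∀ i, residue R (r i) = a i) ∧
            ∀ j, MvPolynomial.eval r (f j) = 0] := by
  have hens := henselianLocalRing_iff_forall_rootMultiplicity_eq_one R
  tfae_have 1 → 2 := fun H ↦ hens.mp (henselianLocalRing_of_isHenselian H)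
  tfae_have 2 → 1 := fun H ↦
    have := hens.mpr H
    isHenselian_of_henselianLocalRing R
  tfae_have 2 → 3 := fun H T _ _ hT ↦
    have := hens.mpr H
    hT.nonempty_algEquiv
  tfae_have 3 → 2 := fun H ↦ hens.mp (henselianLocalRing_of_forall_isPointedEtaleExtension H)
  tfae_have 2 → 4 := fun H _ f a hroot hjac ↦
    have := hens.mpr H
    existsUnique_eval_eq_zero f a hroot hjac
  tfae_have 4 → 2 := fun H ↦ hens.mp <|
    henselianLocalRing_of_forall_exists_eval_eq_zero fun f a hroot hjac ↦
      (H 1 f a hroot hjac).exists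
  tfae_finish
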